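/- **Models.** A distributed graph problem is a relation between a finite simple undirected graph $G=(V,E)$, an input $x_v$ for every node and an output $y_v$ (from a countable set) for every node; outputs $y$ are legal for $(G,x)$ if the relation holds. Let $n=|V|\ge 1$. All nodes know $n$, the nodes carry distinct identifiers from $\{0,\dots,n^k\}$ for a fixed integer $k\ge 1$, and in the randomized models each node has a private infinite sequence of independent fair random bits, independent among nodes. A node's identifier, input and (if applicable) random bits determine its initial state. States, messages and internal computations are unbounded, arbitrary functions. *LOCAL.* In each synchronous round each node sends a message to each of its neighbours, receives their messages and updates its state; after $t(n)$ rounds each node outputs a function of its state. *SLOCAL.* The nodes are processed one after another in an arbitrary order that is fixed independently of the random bits. When $v$ is processed it sees the subgraph induced by its $t(n)$-hop neighbourhood, with the identifiers and current states of the nodes in it, and replaces its own state by an arbitrary function of this view; its output is a function of its final state. The number $t(n)$ is the locality of the algorithm. For $\varepsilon:\mathbb N\to[0,\infty)$ let $\mathsf{P\text{-}RandLOCAL}(\varepsilon(n))$ be the class of problems for which there are a function $t(n)=\log^{O(1)}n$ and a randomized (Monte Carlo) LOCAL algorithm with $t(n)$ rounds whose outputs are random variables that are, for every $n$-node graph,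 every assignment of identifiers and every input, illegal with probability at most $\varepsilon(n)$. Let $\mathsf{P\text{-}RandSLOCAL}(\varepsilon(n))$ be the corresponding class for randomized SLOCAL algorithms with locality $t(n)=\log^{O(1)}n$, where the error bound is required for every processing order. Let $\mathsf{P\text{-}SLOCAL}$ be the class of problems for which there is a deterministic SLOCAL algorithm with locality $\log^{O(1)}n$ whose outputs are legal for every graph, identifiers, input and processing order. **Theorem.** For every function $\varepsilon(n)\ge 0$ and every constant $c>0$, $$\mathsf{P\text{-}RandSLOCAL}(\varepsilon(n))\subseteq \mathsf{P\text{-}RandLOCAL}\bigl(\varepsilon(n)+1/n^c\bigr).$$ In particular, $\mathsf{P\text{-}SLOCAL}\subseteq \mathsf{P\text{-}RandLOCAL}(1/n^c)$ for every constant $c>0$. -/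

import Mathlib

open Filter Asymptotics MeasureTheory

/-- A distributed graph problem: a relation between a graph, the private inputs of its nodes and
the outputs of its nodes.  The relation is arbitrary (an input outside a promise is modelled by
accepting every output). The nodes of an `n`-node graph are named by `Fin n`; algorithms do not
see these names, only the identifiers. -/
structure GraphProblem where
  In : Type
  Out : Type
  [countable_out : Countable Out]
  legal : ∀ {n : ℕ}, SimpleGraph (Fin n) → (Fin n → In) → (Fin n → Out) → Prop

attribute [instance] GraphProblem.countable_out

/-- Unique identifiers from `{0, …, n ^ k}`, that is, identifiers of `O(log n)` bits. -/
def ValidIds (k : ℕ) {n : ℕ} (ident : Fin n → ℕ) : Prop :=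
  Function.Injective ident ∧ ∀ v, ident v ≤ n ^ k

/-! ### The LOCAL model -/

/-- A synchronous message-passing algorithm; `L` is the private information (input, and possibly
random bits) that a node holds at the start. There is no bound on states, messages or internal
computation. -/
structure LocalAlgorithm (L Out : Type) where
  State : Type
  Msg : Type
  /-- initial state, from the number of nodes, the node's identifier and its private information -/
  init : ℕ → ℕ → L → State
  /-- message sent to the neighbour with the given identifier -/
  send : State → ℕ → Msg
  /-- new state, from the old state and the received messages, tagged with their senders -/
  receive : State → Set (ℕ × Msg) → State
  out : State → Out

namespace LocalAlgorithm

variable {L Out : Type} (A : LocalAlgorithm L Out) {n : ℕ} (G : SimpleGraph (Fin n))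
  (ident : Fin n → ℕ) (x : Fin n → L)

/-- The states of all nodes after a number of synchronous rounds. -/
def states : ℕ → Fin n → A.State
  | 0 => fun v => A.init n (ident v) (x v)
  | t + 1 => fun v => A.receive (states t v)
      {m | ∃ u, G.Adj v u ∧ m = (ident u, A.send (states t u) (ident v))}

/-- The outputs of all nodes after `t` rounds. -/
def output (t : ℕ) (v : Fin n) : Out := A.out (A.states G ident x t v)

end LocalAlgorithm

/-! ### The SLOCAL model -/

/-- What a node sees of a neighbourhood: its own identifier, the nodes (identifier and current
state) and the edges of the subgraph induced by the neighbourhood. -/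
structure View (S : Type) where
  center : ℕ
  nodes : Set (ℕ × S)
  edges : Set (ℕ × ℕ)

/-- The view of `v` on its `r`-hop neighbourhood, when the current states are `s`. -/
def viewOf {n : ℕ} (G : SimpleGraph (Fin n)) (ident : Fin n → ℕ) (r : ℕ) {S : Type}
    (s : Fin n → S) (v : Fin n) : View S where
  center := ident v
  nodes := {p | ∃ u, G.edist v u ≤ r ∧ p = (ident u, s u)}
  edges := {p | ∃ u w, G.edist v u ≤ r ∧ G.edist v w ≤ r ∧ G.Adj u w ∧ p = (ident u, ident w)}

/-- A sequential local algorithm; `L` is as for `LocalAlgorithm`. A node's state is initialised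
from its private information and is replaced when the node is processed. -/
structure SLocalAlgorithm (L Out : Type) where
  State : Type
  init : ℕ → ℕ → L → State
  /-- new state of the processed node, from the number of nodes and the node's view -/
  step : ℕ → View State → State
  out : State → Out

namespace SLocalAlgorithm

variable {L Out : Type} (A : SLocalAlgorithm L Out) {n : ℕ} (G : SimpleGraph (Fin n))
  (ident : Fin n → ℕ) (x : Fin n → L)

/-- The states after node `v` is processed with locality `r`, the states before being `s`. -/
def stepAt (r : ℕ) (s : Fin n → A.State) (v : Fin n) : Fin n → A.State :=
  Function.update s v (A.step n (viewOf G ident r s v))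

/-- The outputs with locality `r` when the nodes are processed in the order
`π 0, π 1, …, π (n - 1)`. -/
def output (r : ℕ) (π : Equiv.Perm (Fin n)) (v : Fin n) : Out :=
  A.out ((List.ofFn π).foldl (A.stepAt G ident r) (fun u => A.init n (ident u) (x u)) v)

end SLocalAlgorithm

/-! ### Complexity classes -/

/-- The law of an infinite sequence of independent fair coin flips. -/
noncomputable def coinFlips : Measure (ℕ → Bool) :=
  Measure.infinitePi fun _ : ℕ => (PMF.uniformOfFintype Bool).toMeasure

/-- The law of the private random bits of the nodes, independent among different nodes. -/
noncomputable def nodeBits (n : ℕ) : Measure (Fin n → ℕ → Bool) :=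
  haveI : IsProbabilityMeasure coinFlips := by unfold coinFlips; infer_instance
  Measure.pi fun _ => coinFlips

/-- The random outputs `Y` are random variables, and violate the problem with probability at
most `δ`. -/
def SolvesWithError (P : GraphProblem) {n : ℕ} (G : SimpleGraph (Fin n)) (x : Fin n → P.In)
    (Y : (Fin n → ℕ → Bool) → Fin n → P.Out) (δ : ℝ) : Prop :=
  (∀ v o, MeasurableSet {ω | Y ω v = o}) ∧ (nodeBits n).real {ω | ¬ P.legal G x (Y ω)} ≤ δ

/-- Problems solved by a randomized Monte Carlo LOCAL algorithm in `t` rounds with error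
probability at most `ε`, with identifiers from `{0, …, n ^ k}`. -/
def RandLOCAL (k : ℕ) (t : ℕ → ℕ) (ε : ℕ → ℝ) : Set GraphProblem :=
  {P | ∃ A : LocalAlgorithm (P.In × (ℕ → Bool)) P.Out,
    ∀ n, 1 ≤ n → ∀ (G : SimpleGraph (Fin n)) (ident : Fin n → ℕ), ValidIds k ident →
      ∀ x : Fin n → P.In,
        SolvesWithError P G x (fun ω => A.output G ident (fun v => (x v, ω v)) (t n)) (ε n)}

/-- Problems solved by a randomized Monte Carlo SLOCAL algorithm with locality `t` and error
probability at most `ε`, for every processing order fixed independently of the random bits. -/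
def RandSLOCAL (k : ℕ) (t : ℕ → ℕ) (ε : ℕ → ℝ) : Set GraphProblem :=
  {P | ∃ A : SLocalAlgorithm (P.In × (ℕ → Bool)) P.Out,
    ∀ n, 1 ≤ n → ∀ (G : SimpleGraph (Fin n)) (ident : Fin n → ℕ), ValidIds k ident →
      ∀ (x : Fin n → P.In) (π : Equiv.Perm (Fin n)),
        SolvesWithError P G x (fun ω => A.output G ident (fun v => (x v, ω v)) (t n) π) (ε n)}

/-- Problems solved by a deterministic SLOCAL algorithm with locality `t`, for every processing
order. -/
def SLOCAL (k : ℕ) (t : ℕ → ℕ) : Set GraphProblem :=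
  {P | ∃ A : SLocalAlgorithm P.In P.Out,
    ∀ n, 1 ≤ n → ∀ (G : SimpleGraph (Fin n)) (ident : Fin n → ℕ), ValidIds k ident →
      ∀ (x : Fin n → P.In) (π : Equiv.Perm (Fin n)),
        P.legal G x (A.output G ident x (t n) π)}

/-- `t(n) = log^{O(1)} n`. -/
def IsPolylog (t : ℕ → ℕ) : Prop :=
  ∃ d : ℕ, (fun n => (t n : ℝ)) =O[atTop] fun n : ℕ => Real.log n ^ d

/-- Randomized polylogarithmic-time LOCAL with error probability at most `ε`. -/
def PolyRandLOCAL (k : ℕ) (ε : ℕ → ℝ) : Set GraphProblem :=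
  {P | ∃ t, IsPolylog t ∧ P ∈ RandLOCAL k t ε}

/-- Randomized polylogarithmic-locality SLOCAL with error probability at most `ε`. -/
def PolyRandSLOCAL (k : ℕ) (ε : ℕ → ℝ) : Set GraphProblem :=
  {P | ∃ t, IsPolylog t ∧ P ∈ RandSLOCAL k t ε}

/-- The class P-SLOCAL: deterministic SLOCAL with polylogarithmic locality. -/
def PSLOCAL (k : ℕ) : Set GraphProblem :=
  {P | ∃ t, IsPolylog t ∧ P ∈ SLOCAL k t}

/-! A sequential run can be simulated locally once its order has only short dependency chains. Such
an order comes from a random network decomposition in the style of Linial and Saks. In each of m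
phases every node draws a geometric radius, in units of the locality r and truncated at R; every
node takes as leader the node of largest identifier that reaches it, and is clustered if the leader
reaches it with margin r. Nodes within distance r that are clustered in the same phase share their
leader (`leader_eq_of_edist_le`). Hence, when nodes are processed by first clustering phase and then
by identifier, dependencies within a phase stay around one leader, and only a passage to an earlier
phase costs radius, at most 2Rr + r (`clusterRun_eq_of_agree_leader`). The total radius is O(mRr).

Geometric radii are memoryless: given the past and the leader, the margin is missed with probability
at most 1/2, up to truncation (`nodeBits_leader_unclustered_le`). So some node stays unclustered
with probability at most n(2^-m + 2n 2^-R) (`nodeBits_exists_unclustered_le`), which is at most n^-c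
for suitable m = R = O(log n).

Clustering and sequential algorithm use disjoint halves of the random bits. Given the first half,
the order is fixed, so the error bound ε applies (`solvesWithError_simulation`). A deterministic
algorithm is the case ε = 0. -/

/-! ### Fair coins: splitting and flipping -/

instance isProbabilityMeasure_coinFlips : IsProbabilityMeasure coinFlips := by
  unfold coinFlips; infer_instance

instance isProbabilityMeasure_nodeBits (n : ℕ) : IsProbabilityMeasure (nodeBits n) := by
  unfold nodeBits; infer_instance

/-- The two halves of a bit sequence. -/
def splitBits (f : ℕ → Bool) : (ℕ → Bool) × (ℕ → Bool) :=
  (fun k => f (Equiv.boolProdNatEquivNat (false, k)),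
    fun k => f (Equiv.boolProdNatEquivNat (true, k)))

/-- Reindexing the coins by `Fin 2 × ℕ` and currying turns one infinite product into a product of
two. This gives the clustering and the sequential algorithm independent bits. -/
theorem measurePreserving_splitBits :
    MeasurePreserving splitBits coinFlips (coinFlips.prod coinFlips) := by
  let c : Measure Bool := (PMF.uniformOfFintype Bool).toMeasure
  let e : ℕ ≃ Fin 2 × ℕ :=
    Equiv.boolProdNatEquivNat.symm.trans (Equiv.prodCongrLeft fun _ => finTwoEquiv.symm)
  have h1 : MeasurePreserving (MeasurableEquiv.piCongrLeft (fun _ => Bool) e) coinFlips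
      (Measure.infinitePi fun _ : Fin 2 × ℕ => c) :=
    ⟨by fun_prop, Measure.infinitePi_map_piCongrLeft (fun _ : Fin 2 × ℕ => c) e⟩
  have h2 : MeasurePreserving (MeasurableEquiv.curry (Fin 2) ℕ Bool)
      (Measure.infinitePi fun _ : Fin 2 × ℕ => c) (Measure.pi fun _ : Fin 2 => coinFlips) :=
    ⟨by fun_prop, by
      rw [Measure.infinitePi_map_curry (fun (_ : Fin 2) (_ : ℕ) => c), Measure.infinitePi_eq_pi]
      rfl⟩
  have h3 := (measurePreserving_finTwoArrow coinFlips).comp (h2.comp h1)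
  have h4 (f : ℕ → Bool) (b : Bool) (k : ℕ) :
      MeasurableEquiv.piCongrLeft (fun _ => Bool) e f (finTwoEquiv.symm b, k) =
        f (Equiv.boolProdNatEquivNat (b, k)) := by
    have := Equiv.piCongrLeft_apply_apply (fun _ => Bool) e f (Equiv.boolProdNatEquivNat (b, k))
    rw [← this]
    simp [e, MeasurableEquiv.coe_piCongrLeft]
  convert h3 using 1
  funext f
  exact Prod.ext (funext fun k => (h4 f false k).symm) (funext fun k => (h4 f true k).symm)

/-- The two halves of the bit sequences of all nodes. -/
def splitNodeBits {n : ℕ} (ω : Fin n → ℕ → Bool) :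
    (Fin n → ℕ → Bool) × (Fin n → ℕ → Bool) :=
  (fun v => (splitBits (ω v)).1, fun v => (splitBits (ω v)).2)

theorem measurePreserving_splitNodeBits (n : ℕ) :
    MeasurePreserving splitNodeBits (nodeBits n) ((nodeBits n).prod (nodeBits n)) :=
  (measurePreserving_arrowProdEquivProdArrow _ _ (Fin n) (fun _ => coinFlips)
    fun _ => coinFlips).comp
    (measurePreserving_pi _ _ fun _ : Fin n => measurePreserving_splitBits)

/-- Flip one bit of one node. -/
def flipBit {n : ℕ} (v : Fin n) (a : ℕ) (ω : Fin n → ℕ → Bool) : Fin n → ℕ → Bool :=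
  fun u k => if u = v ∧ k = a then !ω u k else ω u k

theorem measurePreserving_not_uniform :
    MeasurePreserving Bool.not (PMF.uniformOfFintype Bool).toMeasure
      (PMF.uniformOfFintype Bool).toMeasure := by
  refine ⟨measurable_of_countable _, ?_⟩
  rw [PMF.toMeasure_map _ _ (measurable_of_countable _)]
  congr 1
  ext b
  cases b <;> simp [PMF.map_apply]

theorem measurePreserving_flipBit {n : ℕ} (v : Fin n) (a : ℕ) :
    MeasurePreserving (flipBit v a) (nodeBits n) (nodeBits n) := by
  refine measurePreserving_pi (fun _ => coinFlips) (fun _ => coinFlips)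
    (f := fun u g k => if u = v ∧ k = a then !g k else g k) fun u => ?_
  have key (k : ℕ) : MeasurePreserving (fun b : Bool => if u = v ∧ k = a then !b else b)
      (PMF.uniformOfFintype Bool).toMeasure (PMF.uniformOfFintype Bool).toMeasure := by
    by_cases h : u = v ∧ k = a
    · simpa only [h, and_self, if_true] using measurePreserving_not_uniform
    · simp only [h, if_false]
      exact MeasurePreserving.id _
  refine ⟨measurable_pi_iff.2 fun k => (key k).measurable.comp (measurable_pi_apply k), ?_⟩
  unfold coinFlips
  rw [Measure.infinitePi_map_pi (fun _ => (PMF.uniformOfFintype Bool).toMeasure)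
    (f := fun k b => if u = v ∧ k = a then !b else b) fun k => (key k).measurable]
  congr 1
  ext1 k
  exact (key k).map_eq

theorem measurableSet_bit {n : ℕ} (v : Fin n) (a : ℕ) (c : Bool) :
    MeasurableSet {ω : Fin n → ℕ → Bool | ω v a = c} :=
  ((measurable_pi_apply a).comp (measurable_pi_apply v) :
    Measurable fun ω : Fin n → ℕ → Bool => ω v a) (measurableSet_singleton c)

/-- A bit is fair, also conditionally on an event which does not depend on it. -/
theorem nodeBits_inter_bit {n : ℕ} (v : Fin n) (a : ℕ) (c : Bool)
    {E : Set (Fin n → ℕ → Bool)} (hE : MeasurableSet E)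
    (hflip : ∀ ω, flipBit v a ω ∈ E ↔ ω ∈ E) :
    (nodeBits n).real (E ∩ {ω | ω v a = c}) = (nodeBits n).real E / 2 := by
  -- Flipping the bit preserves the measure and exchanges the two parts of `E`.
  have h1 : (nodeBits n).real (E ∩ {ω | ω v a = !c}) =
      (nodeBits n).real (E ∩ {ω | ω v a = c}) := by
    rw [← (measurePreserving_flipBit v a).measureReal_preimage
      (hE.inter (measurableSet_bit v a c)).nullMeasurableSet]
    congr 1
    ext ω
    simp only [Set.mem_inter_iff, Set.mem_ofPred_eq, Set.mem_preimage, hflip, and_congr_right_iff]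
    intro _
    cases h : ω v a <;> cases c <;> simp [flipBit, h]
  have h2 := measureReal_inter_add_sdiff (μ := nodeBits n) (s := E) (measurableSet_bit v a c)
  have h3 : E \ {ω | ω v a = c} = E ∩ {ω | ω v a = !c} := by
    ext ω
    simp only [Set.mem_sdiff, Set.mem_inter_iff, Set.mem_ofPred_eq]
    cases ω v a <;> cases c <;> simp
  rw [h3, h1] at h2
  linarith

/-- Bounds the probability that a radius reaches the truncation. By injectivity of `p`, the next bit
can be flipped without touching the earlier ones. -/
theorem nodeBits_forall_lt {n : ℕ} (v : Fin n) (p : ℕ → ℕ) (hp : p.Injective) (R : ℕ) :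
    (nodeBits n).real {ω | ∀ l < R, ω v (p l) = true} = (1 / 2) ^ R := by
  induction R with
  | zero => simp
  | succ R ih =>
    have hm : MeasurableSet {ω : Fin n → ℕ → Bool | ∀ l < R, ω v (p l) = true} := by
      simp only [Set.ofPred_forall]
      exact .iInter fun l => .iInter fun _ => measurableSet_bit v _ _
    have := nodeBits_inter_bit v (p R) true hm fun ω => by
      simp only [Set.mem_ofPred_eq]
      refine forall₂_congr fun l hl => ?_
      simp [flipBit, hp.eq_iff, hl.ne]
    rw [ih] at this
    rw [pow_succ, ← div_eq_mul_one_div, ← this]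
    congr 1
    ext ω
    simp only [Set.mem_ofPred_eq, Set.mem_inter_iff, Nat.forall_lt_succ_right]

/-! ### Gathering of information in the LOCAL model -/

/-- An `n`-node graph with distinct identifiers and with labels. -/
structure Network (L : Type) (n : ℕ) where
  G : SimpleGraph (Fin n)
  ident : Fin n → ℕ
  inj : Function.Injective ident
  x : Fin n → L

/-- A network of any size, with a distinguished node. -/
abbrev PointedNetwork (L : Type) : Type := (n : ℕ) × Network L n × Fin n

/-- The pointed networks that a node cannot distinguish from its own after `t` rounds. -/
def knowledge {L : Type} : ℕ → PointedNetwork L → Set (PointedNetwork L)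
  | 0, p => {q | q.1 = p.1 ∧ q.2.1.ident q.2.2 = p.2.1.ident p.2.2 ∧
      q.2.1.x q.2.2 = p.2.1.x p.2.2}
  | t + 1, p => {q | q ∈ knowledge t p ∧
      {m | ∃ w, q.2.1.G.Adj q.2.2 w ∧ m = (q.2.1.ident w, knowledge t ⟨q.1, q.2.1, w⟩)} =
      {m | ∃ w, p.2.1.G.Adj p.2.2 w ∧ m = (p.2.1.ident w, knowledge t ⟨p.1, p.2.1, w⟩)}}

section Knowledge

variable {L : Type}

/-- Indistinguishability is an equivalence relation and `knowledge` gives its classes, so a class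
can serve as a message and be compared by equality. -/
theorem mem_knowledge_iff (t : ℕ) (p q : PointedNetwork L) :
    q ∈ knowledge t p ↔ knowledge t q = knowledge t p := by
  induction t generalizing p q with
  | zero =>
    constructor
    · rintro ⟨h1, h2, h3⟩
      simp only [knowledge, h1, h2, h3]
    · intro h
      rw [← h]
      exact ⟨rfl, rfl, rfl⟩
  | succ t ih =>
    constructor
    · rintro ⟨h1, h2⟩
      simp only [knowledge, h2, (ih _ _).1 h1]
    · intro h
      rw [← h]
      exact ⟨(ih _ _).2 rfl, rfl⟩

/-- Two nodes that cannot be distinguished in `t` rounds. -/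
def Agree {n : ℕ} (t : ℕ) (N N' : Network L n) (v v' : Fin n) : Prop :=
  knowledge t ⟨n, N, v⟩ = knowledge t ⟨n, N', v'⟩

variable {n : ℕ} {t s : ℕ} {N N' : Network L n} {v v' w w' : Fin n}

theorem Agree.symm (h : Agree t N N' v v') : Agree t N' N v' v := Eq.symm h

theorem Agree.pred (h : Agree (t + 1) N N' v v') : Agree t N N' v v' :=
  (mem_knowledge_iff _ _ _).1 ((mem_knowledge_iff _ _ _).2 h).1

theorem Agree.mono (h : Agree t N N' v v') (hs : s ≤ t) : Agree s N N' v v' := by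
  induction t, hs using Nat.le_induction with
  | base => exact h
  | succ t _ ih => exact ih h.pred

theorem Agree.ident_eq (h : Agree t N N' v v') : N.ident v = N'.ident v' :=
  ((mem_knowledge_iff _ _ _).2 (h.mono t.zero_le)).2.1

theorem Agree.x_eq (h : Agree t N N' v v') : N.x v = N'.x v' :=
  ((mem_knowledge_iff _ _ _).2 (h.mono t.zero_le)).2.2

theorem Agree.exists_adj (h : Agree (t + 1) N N' v v') (hw : N.G.Adj v w) :
    ∃ w', N'.G.Adj v' w' ∧ Agree t N N' w w' := by
  have h2 := ((mem_knowledge_iff _ _ _).2 h).2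
  obtain ⟨w', h3, h4⟩ := h2.subset ⟨w, hw, rfl⟩
  exact ⟨w', h3, (Prod.ext_iff.1 h4).2⟩

theorem Agree.unique (h : Agree t N N' v v') (hw : Agree s N N' v w') : v' = w' :=
  N'.inj (h.ident_eq.symm.trans hw.ident_eq)

theorem edist_le_natCast_iff {G : SimpleGraph (Fin n)} :
    G.edist v w ≤ (s : ℕ∞) ↔ ∃ p : G.Walk v w, p.length ≤ s := by
  constructor
  · intro h
    obtain ⟨p, hp⟩ := G.exists_walk_of_edist_ne_top (ne_top_of_le_ne_top (ENat.natCast_ne_top s) h)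
    exact ⟨p, by rw [← hp] at h; exact_mod_cast h⟩
  · rintro ⟨p, hp⟩
    exact (SimpleGraph.edist_le p).trans (by exact_mod_cast hp)

/-- A walk is transported edge by edge, each edge costing one round of agreement. -/
theorem Agree.exists_edist_le (h : Agree (t + s) N N' v v') (hw : N.G.edist v w ≤ s) :
    ∃ w', N'.G.edist v' w' ≤ s ∧ Agree t N N' w w' := by
  obtain ⟨p, hp⟩ := edist_le_natCast_iff.1 hw
  clear hw
  induction p generalizing s v' with
  | nil => exact ⟨v', by simp, h.mono (by omega)⟩
  | @cons a b c hab p ih =>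
    obtain ⟨s, rfl⟩ : ∃ k, s = k + 1 := ⟨s - 1, by simp at hp; omega⟩
    obtain ⟨b', hb', hbb⟩ := Agree.exists_adj (t := t + s) h hab
    obtain ⟨w', hw', hww⟩ := ih hbb (by simpa using hp)
    obtain ⟨q, hq⟩ := edist_le_natCast_iff.1 hw'
    exact ⟨w', edist_le_natCast_iff.2 ⟨.cons hb' q, by simpa using hq⟩, hww⟩

theorem Agree.edist_le (h : Agree t N N' v v') (hst : s ≤ t) (hid : N.ident w = N'.ident w')
    (hw : N.G.edist v w ≤ s) : N'.G.edist v' w' ≤ s := by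
  obtain ⟨w'', h1, h2⟩ := Agree.exists_edist_le (t := t - s) (h.mono (by omega)) hw
  rwa [N'.inj (hid.symm.trans h2.ident_eq)]

end Knowledge

/-- Every function of the `T`-hop neighbourhoods is computed by a LOCAL algorithm in `T` rounds. -/
theorem exists_localAlgorithm {L Out : Type} [Nonempty Out] (T : ℕ → ℕ)
    (F : ∀ {n : ℕ}, Network L n → Fin n → Out)
    (hF : ∀ {n : ℕ} (N N' : Network L n) (v v' : Fin n), Agree (T n) N N' v v' →
      F N v = F N' v') :
    ∃ A : LocalAlgorithm L Out, ∀ {n : ℕ} (N : Network L n) (v : Fin n),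
      A.output N.G N.ident N.x (T n) v = F N v := by
  classical
  let A : LocalAlgorithm L Out :=
    -- The first component counts rounds: it tells the node which level of `knowledge` the incoming
    -- messages belong to.
    { State := ℕ × Set (PointedNetwork L)
      Msg := Set (PointedNetwork L)
      init := fun n i l => (0, {q | q.1 = n ∧ q.2.1.ident q.2.2 = i ∧ q.2.1.x q.2.2 = l})
      send := fun s _ => s.2
      receive := fun s M => (s.1 + 1, {q | q ∈ s.2 ∧
        {m | ∃ w, q.2.1.G.Adj q.2.2 w ∧ m = (q.2.1.ident w, knowledge s.1 ⟨q.1, q.2.1, w⟩)} = M})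
      out := fun s => if h : s.2.Nonempty then F h.some.2.1 h.some.2.2
        else Classical.arbitrary Out }
  refine ⟨A, fun {n} N v => ?_⟩
  have key (t : ℕ) (v : Fin n) :
      A.states N.G N.ident N.x t v = (t, knowledge t ⟨n, N, v⟩) := by
    induction t generalizing v with
    | zero => rfl
    | succ t ih =>
      simp only [LocalAlgorithm.states, ih]
      rfl
  have hne : (knowledge (T n) ⟨n, N, v⟩).Nonempty := ⟨_, (mem_knowledge_iff _ _ _).2 rfl⟩
  simp only [LocalAlgorithm.output, key]
  change (if h : (knowledge (T n) ⟨n, N, v⟩).Nonempty then F h.some.2.1 h.some.2.2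
    else Classical.arbitrary Out) = F N v
  rw [dif_pos hne]
  -- Any network in the class may be chosen to evaluate `F`: it has the same size, which is known
  -- from round 0, and `hF` makes the choice irrelevant.
  have hmem := (mem_knowledge_iff _ _ _).1 hne.some_mem
  generalize hne.some = q at hmem
  obtain ⟨n', N', v'⟩ := q
  have hn : n' = n := by
    have := (mem_knowledge_iff _ _ _).2 hmem
    clear * - this
    generalize T n = t at this
    induction t with
    | zero => exact this.1
    | succ t ih => exact ih this.1
  subst hn
  exact hF _ _ _ _ hmem

/-! ### Random clusterings -/

section Clustering

variable {n : ℕ} (G : SimpleGraph (Fin n)) (ident : Fin n → ℕ) (b : Fin n → ℕ → Bool)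
  (r R : ℕ)

/-- In phase `i`, the node `v` reaches the nodes within distance `j * r`, where `j` is the number
of heads (at most `R`) with which its bits for this phase start. -/
def Covers (i : ℕ) (u v : Fin n) : Prop :=
  ∃ j ≤ R, G.edist u v ≤ (j * r : ℕ) ∧ ∀ l < j, b v (Nat.pair i l) = true

/-- The node `v` reaches `u` with a margin of at least `r`. -/
def DeeplyCovers (i : ℕ) (u v : Fin n) : Prop :=
  ∃ j < R, G.edist u v ≤ (j * r : ℕ) ∧ ∀ l ≤ j, b v (Nat.pair i l) = true

/-- The node of largest identifier among those that cover `u`. -/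
def IsLeader (i : ℕ) (u v : Fin n) : Prop :=
  Covers G b r R i u v ∧ ∀ w, Covers G b r R i u w → ident w ≤ ident v

/-- The node `u` belongs to the cluster of its leader in phase `i`. -/
def Clustered (i : ℕ) (u : Fin n) : Prop :=
  ∃ v, IsLeader G ident b r R i u v ∧ DeeplyCovers G b r R i u v

/-- The first of `m` phases in which `u` is clustered, and `m` if there is none. -/
noncomputable def colour (m : ℕ) (u : Fin n) : ℕ := sInf {i | m ≤ i ∨ Clustered G ident b r R i u}

/-- Nodes are processed by colour, and by identifier within a colour. -/
noncomputable def priority (m : ℕ) (u : Fin n) : ℕ ×ₗ ℕ :=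
  toLex (colour G ident b r R m u, ident u)

variable {G ident b r R} {i m : ℕ} {u v w v' : Fin n}

theorem Covers.edist_le (h : Covers G b r R i u v) : G.edist u v ≤ (R * r : ℕ) := by
  obtain ⟨j, hj, h1, -⟩ := h
  exact h1.trans (by exact_mod_cast Nat.mul_le_mul_right r hj)

theorem covers_self (i : ℕ) (u : Fin n) : Covers G b r R i u u := ⟨0, by simp⟩

theorem DeeplyCovers.covers_of_edist_le (h : DeeplyCovers G b r R i u v)
    (huw : G.edist u w ≤ r) : Covers G b r R i w v := by
  obtain ⟨j, hj, h1, h2⟩ := h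
  refine ⟨j + 1, hj, ?_, fun l hl => h2 l (by omega)⟩
  calc G.edist w v ≤ G.edist w u + G.edist u v := SimpleGraph.edist_triangle
    _ ≤ r + (j * r : ℕ) := add_le_add (by rwa [SimpleGraph.edist_comm]) h1
    _ = ((j + 1) * r : ℕ) := by push_cast; ring

theorem exists_isLeader (i : ℕ) (u : Fin n) : ∃ v, IsLeader G ident b r R i u v := by
  classical
  obtain ⟨v, hv, h⟩ := Finset.exists_max_image
    (Finset.univ.filter fun v => Covers G b r R i u v) ident ⟨u, by simp [covers_self]⟩
  exact ⟨v, by simpa using hv, fun w hw => h w (by simpa using hw)⟩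

theorem IsLeader.unique (hid : ident.Injective) (h : IsLeader G ident b r R i u v)
    (h' : IsLeader G ident b r R i u v') : v = v' :=
  hid (le_antisymm (h'.2 _ h.1) (h.2 _ h'.1))

/-- Nodes at distance at most `r` that are clustered in the same phase have the same leader. -/
theorem leader_eq_of_edist_le (hid : ident.Injective) (h : IsLeader G ident b r R i u v)
    (hd : DeeplyCovers G b r R i u v) (h' : IsLeader G ident b r R i w v')
    (hd' : DeeplyCovers G b r R i w v') (huw : G.edist u w ≤ r) : v = v' :=
  -- By the margin, each leader also covers the other node, so it competes there and loses or ties.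
  hid (le_antisymm (h'.2 _ (hd.covers_of_edist_le huw))
    (h.2 _ (hd'.covers_of_edist_le (by rwa [SimpleGraph.edist_comm]))))

theorem clustered_of_colour_lt (h : colour G ident b r R m u < m) :
    Clustered G ident b r R (colour G ident b r R m u) u :=
  (Nat.sInf_mem (s := {i | m ≤ i ∨ Clustered G ident b r R i u}) ⟨m, .inl le_rfl⟩).resolve_left
    h.not_ge

theorem not_clustered_of_not_colour_lt (h : ¬ colour G ident b r R m u < m) (hi : i < m) :
    ¬ Clustered G ident b r R i u := fun hc =>
  h ((Nat.sInf_le (s := {i | m ≤ i ∨ Clustered G ident b r R i u}) (.inr hc)).trans_lt hi)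

theorem priority_injective (hid : ident.Injective) :
    Function.Injective (priority G ident b r R m) := fun _ _ h =>
  hid (congrArg (fun p => (ofLex p).2) h)

end Clustering

/-! ### Locality of the clustering -/

section ClusteringLocality

variable {L : Type} {n : ℕ} {N N' : Network L n} {β : L → ℕ → Bool} {r R i m t : ℕ}
  {u u' v v' : Fin n}

theorem Agree.covers (h : Agree (R * r) N N' u u') (hv : Agree 0 N N' v v')
    (hc : Covers N.G (β ∘ N.x) r R i u v) : Covers N'.G (β ∘ N'.x) r R i u' v' := by
  obtain ⟨j, hj, h1, h2⟩ := hc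
  refine ⟨j, hj, h.edist_le (Nat.mul_le_mul_right r hj) hv.ident_eq h1, ?_⟩
  simpa [← hv.x_eq] using h2

theorem Agree.deeplyCovers (h : Agree (R * r) N N' u u') (hv : Agree 0 N N' v v')
    (hc : DeeplyCovers N.G (β ∘ N.x) r R i u v) :
    DeeplyCovers N'.G (β ∘ N'.x) r R i u' v' := by
  obtain ⟨j, hj, h1, h2⟩ := hc
  refine ⟨j, hj, h.edist_le (Nat.mul_le_mul_right r hj.le) hv.ident_eq h1, ?_⟩
  simpa [← hv.x_eq] using h2

/-- All competitors lie within distance `R * r`, so each has a counterpart in the other network. -/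
theorem Agree.isLeader (h : Agree (R * r) N N' u u') (hv : Agree 0 N N' v v')
    (hl : IsLeader N.G N.ident (β ∘ N.x) r R i u v) :
    IsLeader N'.G N'.ident (β ∘ N'.x) r R i u' v' := by
  refine ⟨h.covers hv hl.1, fun w' hw' => ?_⟩
  obtain ⟨w, -, hw⟩ := Agree.exists_edist_le (t := 0) (h.symm.mono (by omega)) hw'.edist_le
  rw [hw.ident_eq, ← hv.ident_eq]
  exact hl.2 w (h.symm.covers hw hw')

theorem Agree.clustered (h : Agree (R * r) N N' u u')
    (hc : Clustered N.G N.ident (β ∘ N.x) r R i u) :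
    Clustered N'.G N'.ident (β ∘ N'.x) r R i u' := by
  obtain ⟨v, hl, hd⟩ := hc
  obtain ⟨v', -, hv⟩ := Agree.exists_edist_le (t := 0) (h.mono (by omega)) hl.1.edist_le
  exact ⟨v', h.isLeader hv hl, h.deeplyCovers hv hd⟩

/-- Each phase is decided by the same ball, so the radius does not grow with `m`. -/
theorem Agree.colour_eq (h : Agree (R * r) N N' u u') :
    colour N.G N.ident (β ∘ N.x) r R m u = colour N'.G N'.ident (β ∘ N'.x) r R m u' := by
  unfold colour
  congr 1
  ext i
  exact or_congr_right ⟨h.clustered, h.symm.clustered⟩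

theorem Agree.priority_eq (h : Agree (R * r) N N' u u') :
    priority N.G N.ident (β ∘ N.x) r R m u = priority N'.G N'.ident (β ∘ N'.x) r R m u' := by
  unfold priority
  rw [h.colour_eq, h.ident_eq]

end ClusteringLocality

/-! ### Sequential runs by priority -/

namespace SLocalAlgorithm

variable {L Out : Type} (A : SLocalAlgorithm L Out) {n : ℕ} (G : SimpleGraph (Fin n))
  (ident : Fin n → ℕ) (x : Fin n → L) (r : ℕ)

theorem foldl_stepAt_of_notMem (l : List (Fin n)) (s : Fin n → A.State) {u : Fin n}
    (hu : u ∉ l) : l.foldl (A.stepAt G ident r) s u = s u := by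
  induction l generalizing s with
  | nil => rfl
  | cons a l ih =>
    rw [List.mem_cons, not_or] at hu
    rw [List.foldl_cons, ih _ hu.2, stepAt, Function.update_of_ne hu.1]

-- Replaces the list by a recursion along keys: a processed node sees final states at smaller keys
-- of the list and the starting states elsewhere. Locality is then proved by induction on keys.
open Classical in
theorem foldl_stepAt {K : Type*} [LinearOrder K] (key : Fin n → K) (l : List (Fin n))
    (hl : l.Pairwise fun u w => key u < key w) (s : Fin n → A.State) {u : Fin n} (hu : u ∈ l) :
    l.foldl (A.stepAt G ident r) s u = A.step n (viewOf G ident r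
      (fun w => if w ∈ l ∧ key w < key u then l.foldl (A.stepAt G ident r) s w else s w) u) := by
  induction l generalizing s with
  | nil => simp at hu
  | cons a l ih =>
    rw [List.pairwise_cons] at hl
    have ha : a ∉ l := fun h => lt_irrefl _ (hl.1 a h)
    have hsa : (a :: l).foldl (A.stepAt G ident r) s a = A.step n (viewOf G ident r s a) := by
      rw [List.foldl_cons, A.foldl_stepAt_of_notMem G ident r _ _ ha, stepAt,
        Function.update_self]
    rcases List.mem_cons.1 hu with rfl | hul
    · rw [hsa]
      congr 2
      funext w
      rw [if_neg]
      rintro ⟨hw, hlt⟩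
      rcases List.mem_cons.1 hw with rfl | hw
      · exact lt_irrefl _ hlt
      · exact lt_asymm hlt (hl.1 w hw)
    · rw [List.foldl_cons, ih hl.2 _ hul]
      congr 2
      funext w
      by_cases hwa : w = a
      · subst hwa
        rw [if_neg fun h => ha h.1, if_pos ⟨List.mem_cons_self, hl.1 u hul⟩,
          A.foldl_stepAt_of_notMem G ident r _ _ ha]
      · simp [hwa, stepAt]

/-- The final states, when the nodes are processed by increasing keys. -/
noncomputable def finalState {K : Type*} [LinearOrder K] (key : Fin n → K) : Fin n → A.State :=
  (List.ofFn (Tuple.sort key)).foldl (A.stepAt G ident r) (fun u => A.init n (ident u) (x u))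

open Classical in
theorem finalState_eq {K : Type*} [LinearOrder K] {key : Fin n → K}
    (hkey : Function.Injective key) (u : Fin n) :
    A.finalState G ident x r key u = A.step n (viewOf G ident r
      (fun w => if key w < key u then A.finalState G ident x r key w
        else A.init n (ident w) (x w)) u) := by
  have hmem (w : Fin n) : w ∈ List.ofFn (Tuple.sort key) := by
    simpa using (Tuple.sort key).surjective w
  have hl : (List.ofFn (Tuple.sort key)).Pairwise fun u w => key u < key w := by
    rw [List.pairwise_ofFn]
    intro i j hij
    exact lt_of_le_of_ne (Tuple.monotone_sort key hij.le)
      fun h => hij.ne ((Tuple.sort key).injective (hkey h))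
  have := A.foldl_stepAt G ident r key _ hl (fun u => A.init n (ident u) (x u)) (hmem u)
  simp only [hmem, true_and] at this
  exact this

end SLocalAlgorithm

/-! ### Locality of the run ordered by clusters -/

section RunLocality

variable {L L' Out : Type} (A : SLocalAlgorithm L' Out) (β : L → ℕ → Bool) (lab : L → L')
  (r R m : ℕ)

/-- The final states in a network whose labels provide the bits for the clustering and the private
information for the sequential algorithm. -/
noncomputable def clusterRun {n : ℕ} (N : Network L n) : Fin n → A.State :=
  A.finalState N.G N.ident (lab ∘ N.x) r (priority N.G N.ident (β ∘ N.x) r R m)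

variable {n : ℕ} {N N' : Network L n}

theorem viewOf_nodes_subset {S : Type} {t : ℕ} {s s' : Fin n → S} {u u' : Fin n}
    (h : Agree (t + r) N N' u u')
    (hs : ∀ w w', N.G.edist u w ≤ r → Agree t N N' w w' → s w = s' w') :
    (viewOf N.G N.ident r s u).nodes ⊆ (viewOf N'.G N'.ident r s' u').nodes := by
  rintro _ ⟨w, hw, rfl⟩
  obtain ⟨w', hw', hww⟩ := h.exists_edist_le hw
  exact ⟨w', hw', by rw [hww.ident_eq, hs w w' hw hww]⟩

/-- The additional round is for edges joining two nodes at distance exactly `r` from the centre. -/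
theorem viewOf_edges_subset {S : Type} {t : ℕ} {s s' : Fin n → S} {u u' : Fin n}
    (h : Agree (t + 1 + r) N N' u u') :
    (viewOf N.G N.ident r s u).edges ⊆ (viewOf N'.G N'.ident r s' u').edges := by
  rintro _ ⟨w, z, hw, hz, hwz, rfl⟩
  obtain ⟨w', hw', hww⟩ := h.exists_edist_le hw
  obtain ⟨z', hz', hzz⟩ := hww.exists_adj hwz
  exact ⟨w', z', hw', h.edist_le (by omega) hzz.ident_eq hz, hz', by
    rw [hww.ident_eq, hzz.ident_eq]⟩

theorem viewOf_eq {S : Type} {t : ℕ} {s s' : Fin n → S} {u u' : Fin n}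
    (h : Agree (t + 1 + r) N N' u u')
    (hs : ∀ w w', N.G.edist u w ≤ r → Agree (t + 1) N N' w w' → s w = s' w') :
    viewOf N.G N.ident r s u = viewOf N'.G N'.ident r s' u' := by
  have hn : (viewOf N.G N.ident r s u).nodes = (viewOf N'.G N'.ident r s' u').nodes := by
    refine (viewOf_nodes_subset r h hs).antisymm (viewOf_nodes_subset r h.symm ?_)
    intro w' w hw' hww
    exact (hs w w' (h.symm.edist_le (by omega) hww.ident_eq hw') hww.symm).symm
  have he : (viewOf N.G N.ident r s u).edges = (viewOf N'.G N'.ident r s' u').edges :=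
    (viewOf_edges_subset r h).antisymm (viewOf_edges_subset r h.symm)
  have hc : (viewOf N.G N.ident r s u).center = (viewOf N'.G N'.ident r s' u').center :=
    h.ident_eq
  revert hn he hc
  generalize viewOf N.G N.ident r s u = V
  generalize viewOf N'.G N'.ident r s' u' = V'
  cases V; cases V'
  rintro rfl rfl rfl
  rfl

/-- Agreement is required around the leader, not around `u`: the induction on priorities then stays
in one ball as long as the phase does not change. -/
theorem clusterRun_eq_of_agree_leader {u u' ℓ ℓ' : Fin n}
    (hm : colour N.G N.ident (β ∘ N.x) r R m u < m)
    (hl : IsLeader N.G N.ident (β ∘ N.x) r R (colour N.G N.ident (β ∘ N.x) r R m u) u ℓ)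
    (hd : DeeplyCovers N.G (β ∘ N.x) r R (colour N.G N.ident (β ∘ N.x) r R m u) u ℓ)
    (hid : N.ident u = N'.ident u')
    (h : Agree ((colour N.G N.ident (β ∘ N.x) r R m u + 1) * (2 * (R * r) + r) + 1) N N' ℓ ℓ') :
    clusterRun A β lab r R m N u = clusterRun A β lab r R m N' u' := by
  classical
  induction hk : priority N.G N.ident (β ∘ N.x) r R m u using WellFoundedLT.induction
    generalizing u u' ℓ ℓ' with
  | ind k ih =>
  subst hk
  generalize hi : colour N.G N.ident (β ∘ N.x) r R m u = i at *
  -- Moving from the leader to `u` costs `R * r`; the last `r` pays for the view.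
  have hu : Agree (i * (2 * (R * r) + r) + R * r + 1 + r) N N' u u' := by
    obtain ⟨u'', -, h2⟩ := Agree.exists_edist_le (t := i * (2 * (R * r) + r) + R * r + 1 + r)
      (s := R * r) (w := u) (h.mono (le_of_eq (by ring)))
      (by rw [SimpleGraph.edist_comm]; exact hl.1.edist_le)
    rwa [N'.inj (hid.symm.trans h2.ident_eq)]
  unfold clusterRun
  rw [A.finalState_eq _ _ _ _ (priority_injective N.inj),
    A.finalState_eq _ _ _ _ (priority_injective N'.inj)]
  congr 1
  refine viewOf_eq r hu fun w w' hw hww => ?_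
  have hww0 : Agree (R * r) N N' w w' := hww.mono (by
    have := Nat.zero_le (i * (2 * (R * r) + r)); omega)
  have hu0 : Agree (R * r) N N' u u' := hu.mono (by
    have := Nat.zero_le (i * (2 * (R * r) + r)); omega)
  rw [← hww0.priority_eq, ← hu0.priority_eq]
  split_ifs with hlt
  · have hle : colour N.G N.ident (β ∘ N.x) r R m w ≤ i := by
      rw [← hi]
      rcases Prod.Lex.toLex_lt_toLex.1 hlt with h1 | h1
      · exact h1.le
      · exact h1.1.le
    obtain ⟨ℓ₂, hl₂, hd₂⟩ := clustered_of_colour_lt (hle.trans_lt hm)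
    rcases hle.eq_or_lt with heq | hlt'
    -- Same phase: the leader is the same, and no radius is lost.
    · have : ℓ = ℓ₂ := leader_eq_of_edist_le N.inj hl hd (heq ▸ hl₂) (heq ▸ hd₂) hw
      subst this
      exact ih _ hlt (hle.trans_lt hm) hl₂ hd₂ hww.ident_eq (by rwa [heq]) rfl
    -- Earlier phase: moving to the new leader costs another `R * r`, and the factor `i + 1` has
    -- dropped to at most `i`.
    · obtain ⟨ℓ₂', -, hℓ⟩ := Agree.exists_edist_le
        (t := (colour N.G N.ident (β ∘ N.x) r R m w + 1) * (2 * (R * r) + r) + 1) (s := R * r)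
        (hww.mono (by
          have := Nat.mul_le_mul_right (2 * (R * r) + r) (Nat.succ_le_of_lt hlt')
          rw [Nat.succ_eq_add_one] at this
          omega)) hl₂.1.edist_le
      exact ih _ hlt (hle.trans_lt hm) hl₂ hd₂ hww.ident_eq hℓ rfl
  · simp [hww.ident_eq, hww.x_eq]

/-- The output of the sequential algorithm at the clustered nodes. -/
noncomputable def clusterOutput (o : Out) (N : Network L n) (v : Fin n) : Out :=
  if colour N.G N.ident (β ∘ N.x) r R m v < m then A.out (clusterRun A β lab r R m N v) else o

/-- The leader is within `R * r` and the phase is below `m`. Unclustered nodes have no leader to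
bound their dependencies, hence the default `o`; they come last in the order and do not influence
the others. -/
theorem clusterOutput_eq_of_agree (o : Out) {v v' : Fin n}
    (h : Agree (m * (2 * (R * r) + r) + 1 + R * r) N N' v v') :
    clusterOutput A β lab r R m o N v = clusterOutput A β lab r R m o N' v' := by
  have hc := Agree.colour_eq (β := β) (m := m) (h.mono (Nat.le_add_left (R * r) _))
  unfold clusterOutput
  rw [← hc]
  split_ifs with hm
  · obtain ⟨ℓ, hl, hd⟩ := clustered_of_colour_lt hm
    obtain ⟨ℓ', -, hℓ⟩ := h.exists_edist_le hl.1.edist_le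
    rw [clusterRun_eq_of_agree_leader A β lab r R m hm hl hd h.ident_eq (hℓ.mono (by
      have := Nat.mul_le_mul_right (2 * (R * r) + r) (Nat.succ_le_of_lt hm)
      rw [Nat.succ_eq_add_one] at this
      omega))]
  · rfl

end RunLocality

/-! ### The probability that a node stays unclustered -/

section Probability

variable {n : ℕ} {G : SimpleGraph (Fin n)} {ident : Fin n → ℕ} {r R i k m : ℕ} {u v w : Fin n}

/-- If some radius reaches `u`, the least such radius is already enough, so only the bits below it
matter. -/
theorem Covers.congr {b b' : Fin n → ℕ → Bool} (h : Covers G b r R i u v)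
    (hb : ∀ l, ¬ G.edist u v ≤ (l * r : ℕ) → b v (Nat.pair i l) = b' v (Nat.pair i l)) :
    Covers G b' r R i u v := by
  classical
  obtain ⟨j, hj, h1, h2⟩ := h
  have hex : ∃ j : ℕ, G.edist u v ≤ (j * r : ℕ) := ⟨j, h1⟩
  have hle := Nat.find_min' hex h1
  refine ⟨Nat.find hex, hle.trans hj, Nat.find_spec hex, fun l hl => ?_⟩
  rw [← hb l (Nat.find_min hex hl)]
  exact h2 l (hl.trans_le hle)

theorem clustered_congr {b b' : Fin n → ℕ → Bool}
    (hb : ∀ v l, b v (Nat.pair i l) = b' v (Nat.pair i l)) :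
    Clustered G ident b r R i u ↔ Clustered G ident b' r R i u := by
  simp only [Clustered, IsLeader, Covers, DeeplyCovers, hb]

theorem isLeader_congr {b b' : Fin n → ℕ → Bool}
    (hb : ∀ v l, ¬ G.edist u v ≤ (l * r : ℕ) → b v (Nat.pair i l) = b' v (Nat.pair i l)) :
    IsLeader G ident b r R i u v ↔ IsLeader G ident b' r R i u v := by
  have (w : Fin n) : Covers G b r R i u w ↔ Covers G b' r R i u w :=
    ⟨fun h => h.congr (hb w), fun h => h.congr fun l hl => (hb w l hl).symm⟩
  simp only [IsLeader, this]

variable (G ident r R)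

theorem measurable_covers (i : ℕ) (u v : Fin n) :
    Measurable fun b : Fin n → ℕ → Bool => Covers G b r R i u v := by
  unfold Covers
  refine .exists fun j => .and measurable_const (.and measurable_const ?_)
  exact .forall fun l => .imp measurable_const (measurableSet_setOfPred.1 (measurableSet_bit _ _ _))

theorem measurable_deeplyCovers (i : ℕ) (u v : Fin n) :
    Measurable fun b : Fin n → ℕ → Bool => DeeplyCovers G b r R i u v := by
  unfold DeeplyCovers
  refine .exists fun j => .and measurable_const (.and measurable_const ?_)
  exact .forall fun l => .imp measurable_const (measurableSet_setOfPred.1 (measurableSet_bit _ _ _))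

theorem measurable_isLeader (i : ℕ) (u v : Fin n) :
    Measurable fun b : Fin n → ℕ → Bool => IsLeader G ident b r R i u v :=
  (measurable_covers G r R i u v).and
    (.forall fun w => (measurable_covers G r R i u w).imp measurable_const)

theorem measurable_clustered (i : ℕ) (u : Fin n) :
    Measurable fun b : Fin n → ℕ → Bool => Clustered G ident b r R i u :=
  .exists fun v =>
    (measurable_isLeader G ident r R i u v).and (measurable_deeplyCovers G r R i u v)

theorem measurable_colour (m : ℕ) (u : Fin n) :
    Measurable fun b : Fin n → ℕ → Bool => colour G ident b r R m u := by
  refine measurable_to_countable' fun c => ?_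
  have : (fun b : Fin n → ℕ → Bool => colour G ident b r R m u) ⁻¹' {c} =
      {b | (m ≤ c ∨ Clustered G ident b r R c u) ∧
        ∀ i < c, ¬ (m ≤ i ∨ Clustered G ident b r R i u)} := by
    ext b
    have hne : {i | m ≤ i ∨ Clustered G ident b r R i u}.Nonempty := ⟨m, .inl le_rfl⟩
    constructor
    · rintro rfl
      exact ⟨Nat.sInf_mem hne, fun i hi => Nat.notMem_of_lt_sInf hi⟩
    · rintro ⟨h1, h2⟩
      exact le_antisymm (Nat.sInf_le h1) (not_lt.1 fun hlt => h2 _ hlt (Nat.sInf_mem hne))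
  rw [this]
  refine measurableSet_setOfPred.2 (.and (.or measurable_const (measurable_clustered _ _ _ _ _ _)) ?_)
  exact .forall fun i => .imp measurable_const
    (.not (.or measurable_const (measurable_clustered _ _ _ _ _ _)))

/-- The event that a node is not clustered in any of the first `k` phases. -/
def unclusteredEvent (k : ℕ) (u : Fin n) : Set (Fin n → ℕ → Bool) :=
  {b | ∀ i < k, ¬ Clustered G ident b r R i u}

theorem measurableSet_unclusteredEvent (k : ℕ) (u : Fin n) :
    MeasurableSet (unclusteredEvent G ident r R k u) :=
  measurableSet_setOfPred.2 <| .forall fun _ => .imp measurable_const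
    (.not (measurable_clustered _ _ _ _ _ _))

/-- Let d be the least multiple of `r` with which `v` reaches `u`. The past phases and the
leadership of `v` do not depend on bit d of `v` in phase `k`, and heads there provides the margin if
d < `R`. -/
theorem nodeBits_leader_unclustered_le (k : ℕ) (u v : Fin n) :
    (nodeBits n).real (unclusteredEvent G ident r R k u ∩ {b | IsLeader G ident b r R k u v} ∩
      {b | ¬ Clustered G ident b r R k u}) ≤
    (nodeBits n).real (unclusteredEvent G ident r R k u ∩
      {b | IsLeader G ident b r R k u v}) / 2 + (1 / 2) ^ R := by
  classical
  by_cases hex : ∃ j : ℕ, G.edist u v ≤ (j * r : ℕ)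
  · have hcov {b : Fin n → ℕ → Bool} (h : Covers G b r R k u v) :
        Nat.find hex ≤ R ∧ ∀ l < Nat.find hex, b v (Nat.pair k l) = true := by
      obtain ⟨j, hj, h1, h2⟩ := h
      have hle := Nat.find_min' hex h1
      exact ⟨hle.trans hj, fun l hl => h2 l (hl.trans_le hle)⟩
    rcases lt_or_ge (Nat.find hex) R with hd | hd
    · have hE := (measurableSet_unclusteredEvent G ident r R k u).inter
        (measurableSet_setOfPred.2 (measurable_isLeader G ident r R k u v))
      rw [← nodeBits_inter_bit v (Nat.pair k (Nat.find hex)) false hE]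
      · refine (measureReal_mono ?_).trans (le_add_of_nonneg_right (by positivity))
        rintro b ⟨hb, hnc⟩
        refine ⟨hb, ?_⟩
        by_contra hbit
        refine hnc ⟨v, hb.2, Nat.find hex, hd, Nat.find_spec hex, fun l hl => ?_⟩
        rcases hl.eq_or_lt with rfl | hl
        · simpa using hbit
        · exact (hcov hb.2.1).2 l hl
      · intro b
        refine and_congr (forall₂_congr fun i hi => not_congr (clustered_congr fun w l => ?_))
          (isLeader_congr fun w l hl => ?_)
        · simp [flipBit, hi.ne]
        · refine if_neg ?_
          rintro ⟨rfl, h⟩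
          rw [Nat.pair_eq_pair] at h
          rw [h.2] at hl
          exact hl (Nat.find_spec hex)
    -- Here covering `u` alone already requires `R` heads.
    · rw [← nodeBits_forall_lt v (Nat.pair k) (fun a b h => (Nat.pair_eq_pair.1 h).2) R]
      refine (measureReal_mono ?_).trans (le_add_of_nonneg_left (by positivity))
      rintro b ⟨hb, -⟩ l hl
      exact (hcov hb.2.1).2 l (hl.trans_le hd)
  · have : unclusteredEvent G ident r R k u ∩ {b | IsLeader G ident b r R k u v} ∩
        {b | ¬ Clustered G ident b r R k u} = ∅ := by
      refine Set.eq_empty_of_forall_notMem fun b hb => hex ?_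
      obtain ⟨j, -, h1, -⟩ := hb.1.2.1
      exact ⟨j, h1⟩
    rw [this, measureReal_empty]
    positivity

theorem nodeBits_unclusteredEvent_succ_le (hid : ident.Injective) (k : ℕ) (u : Fin n) :
    (nodeBits n).real (unclusteredEvent G ident r R (k + 1) u) ≤
      (nodeBits n).real (unclusteredEvent G ident r R k u) / 2 + n * (1 / 2) ^ R := by
  calc (nodeBits n).real (unclusteredEvent G ident r R (k + 1) u)
      ≤ (nodeBits n).real (⋃ v, unclusteredEvent G ident r R k u ∩
          {b | IsLeader G ident b r R k u v} ∩ {b | ¬ Clustered G ident b r R k u}) := by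
        refine measureReal_mono fun b hb => ?_
        obtain ⟨v, hv⟩ := exists_isLeader (G := G) (ident := ident) (b := b) (r := r) (R := R) k u
        exact Set.mem_iUnion.2
          ⟨v, ⟨fun i hi => hb i (hi.trans k.lt_succ_self), hv⟩, hb k k.lt_succ_self⟩
    _ ≤ ∑ v, (nodeBits n).real (unclusteredEvent G ident r R k u ∩
          {b | IsLeader G ident b r R k u v} ∩ {b | ¬ Clustered G ident b r R k u}) :=
        measureReal_iUnion_fintype_le _
    _ ≤ ∑ v, ((nodeBits n).real (unclusteredEvent G ident r R k u ∩
          {b | IsLeader G ident b r R k u v}) / 2 + (1 / 2) ^ R) :=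
        Finset.sum_le_sum fun v _ => nodeBits_leader_unclustered_le G ident r R k u v
    _ = (∑ v, (nodeBits n).real (unclusteredEvent G ident r R k u ∩
          {b | IsLeader G ident b r R k u v})) / 2 + n * (1 / 2) ^ R := by
        rw [Finset.sum_add_distrib, Finset.sum_div]
        simp
    _ ≤ _ := by
        gcongr
        -- Leaders are unique, so these events are disjoint.
        rw [← measureReal_iUnion_fintype]
        · exact measureReal_mono (Set.iUnion_subset fun v => Set.inter_subset_left)
        · exact fun v w hvw => Set.disjoint_left.2 fun b hv hw => hvw (hv.2.unique hid hw.2)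
        · exact fun v => (measurableSet_unclusteredEvent G ident r R k u).inter
            (measurableSet_setOfPred.2 (measurable_isLeader G ident r R k u v))

theorem nodeBits_unclusteredEvent_le (hid : ident.Injective) (k : ℕ) (u : Fin n) :
    (nodeBits n).real (unclusteredEvent G ident r R k u) ≤
      (1 / 2) ^ k + 2 * n * (1 / 2) ^ R := by
  induction k with
  | zero =>
    refine measureReal_le_one.trans ?_
    rw [pow_zero]
    exact le_add_of_nonneg_right (by positivity)
  | succ k ih =>
    refine (nodeBits_unclusteredEvent_succ_le G ident r R hid k u).trans ?_
    rw [pow_succ]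
    linarith

theorem nodeBits_exists_unclustered_le (hid : ident.Injective) (m : ℕ) :
    (nodeBits n).real {b | ∃ u, ¬ colour G ident b r R m u < m} ≤
      n * ((1 / 2) ^ m + 2 * n * (1 / 2) ^ R) := by
  calc (nodeBits n).real {b | ∃ u, ¬ colour G ident b r R m u < m}
      ≤ (nodeBits n).real (⋃ u, unclusteredEvent G ident r R m u) :=
        measureReal_mono fun b ⟨u, hu⟩ =>
          Set.mem_iUnion.2 ⟨u, fun i hi => not_clustered_of_not_colour_lt hu hi⟩
    _ ≤ ∑ u, (nodeBits n).real (unclusteredEvent G ident r R m u) :=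
        measureReal_iUnion_fintype_le _
    _ ≤ ∑ _u : Fin n, ((1 / 2) ^ m + 2 * n * (1 / 2) ^ R : ℝ) :=
        Finset.sum_le_sum fun u _ => nodeBits_unclusteredEvent_le G ident r R hid m u
    _ = _ := by rw [Finset.sum_const, Finset.card_univ, Fintype.card_fin, nsmul_eq_mul]

end Probability

/-! ### Error probability of the simulation -/

section Simulation

variable {n : ℕ} {In Out : Type} (A : SLocalAlgorithm (In × (ℕ → Bool)) Out)
  (G : SimpleGraph (Fin n)) (ident : Fin n → ℕ) (x : Fin n → In) (r R m : ℕ) (o : Out)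

/-- The output of the sequential algorithm, in the order given by a colouring, at the nodes with
proper colours. -/
noncomputable def colouringOutput (c : Fin n → ℕ) (γ : Fin n → ℕ → Bool) (v : Fin n) : Out :=
  if c v < m then
    A.output G ident (fun u => (x u, γ u)) r (Tuple.sort fun u => toLex (c u, ident u)) v
  else o

/-- The simulation of a randomized sequential algorithm: half of the random bits are used for the
clustering, and half of them for the sequential algorithm. -/
noncomputable def simulation {n : ℕ} (N : Network (In × (ℕ → Bool)) n) (v : Fin n) : Out :=
  clusterOutput A (fun p => (splitBits p.2).1) (fun p => (p.1, (splitBits p.2).2)) r R m o N v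

/-- The order depends on the first halves of the bits only, and the sequential algorithm reads the
second halves only. -/
theorem simulation_eq (hid : ident.Injective) (ω : Fin n → ℕ → Bool) :
    simulation A r R m o ⟨G, ident, hid, fun v => (x v, ω v)⟩ =
      colouringOutput A G ident x r m o
        (fun u => colour G ident (splitNodeBits ω).1 r R m u) (splitNodeBits ω).2 := rfl

variable {A G ident x r R m o}

theorem measurable_of_forall_measurableSet_eq {Ω : Type*} [MeasurableSpace Ω] [Countable Out]
    {Y : Ω → Fin n → Out} (hY : ∀ v o, MeasurableSet {ω | Y ω v = o}) :
    @Measurable _ _ _ (@MeasurableSpace.pi _ _ fun _ => ⊤) Y :=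
  let _ : MeasurableSpace Out := ⊤
  measurable_pi_iff.2 fun v => measurable_to_countable' fun o => hY v o

/-- There are countably many output vectors, so an arbitrary legality relation defines an event. -/
theorem measurableSet_of_countable_out {Ω : Type*} [MeasurableSpace Ω] [Countable Out]
    {Y : Ω → Fin n → Out} (hY : ∀ v o, MeasurableSet {ω | Y ω v = o}) (S : (Fin n → Out) → Prop) :
    MeasurableSet {ω | S (Y ω)} := by
  let _ : MeasurableSpace Out := ⊤
  exact measurable_of_forall_measurableSet_eq hY (Set.to_countable {y | S y}).measurableSet

variable (P : GraphProblem) {A : SLocalAlgorithm (P.In × (ℕ → Bool)) P.Out} {x : Fin n → P.In}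
  {o : P.Out} {ε : ℝ}

/-- There are countably many colourings, and for each of them the order is a fixed permutation, to
which `hA` applies. -/
theorem measurableSet_colouringOutput
    (hA : ∀ π, SolvesWithError P G x (fun ω => A.output G ident (fun v => (x v, ω v)) r π) ε)
    (v : Fin n) (y : P.Out) :
    MeasurableSet {p : (Fin n → ℕ → Bool) × (Fin n → ℕ → Bool) |
      colouringOutput A G ident x r m o (fun u => colour G ident p.1 r R m u) p.2 v = y} := by
  let _ : MeasurableSpace P.Out := ⊤
  have h1 : Measurable fun q : (Fin n → ℕ) × (Fin n → ℕ → Bool) =>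
      colouringOutput A G ident x r m o q.1 q.2 v := by
    refine measurable_from_prod_countable_right fun c => ?_
    dsimp only [colouringOutput]
    split_ifs
    · exact measurable_to_countable' fun o => (hA _).1 v o
    · exact measurable_const
  have h2 : Measurable fun p : (Fin n → ℕ → Bool) × (Fin n → ℕ → Bool) =>
      ((fun u => colour G ident p.1 r R m u), p.2) :=
    (measurable_pi_iff.2 fun u =>
      (measurable_colour G ident r R m u).comp measurable_fst).prodMk measurable_snd
  exact (h1.comp h2) (MeasurableSpace.measurableSet_top (s := {y}))

theorem solvesWithError_simulation (hε : 0 ≤ ε) (hid : ident.Injective)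
    (hA : ∀ π, SolvesWithError P G x (fun ω => A.output G ident (fun v => (x v, ω v)) r π) ε) :
    SolvesWithError P G x
      (fun ω => simulation A r R m o ⟨G, ident, hid, fun v => (x v, ω v)⟩)
      (ε + n * ((1 / 2) ^ m + 2 * n * (1 / 2) ^ R)) := by
  have hmp := measurePreserving_splitNodeBits n
  let Z (p : (Fin n → ℕ → Bool) × (Fin n → ℕ → Bool)) : Fin n → P.Out :=
    colouringOutput A G ident x r m o (fun u => colour G ident p.1 r R m u) p.2
  have hZ : ∀ v y, MeasurableSet {p | Z p v = y} := measurableSet_colouringOutput P hA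
  simp only [simulation_eq]
  refine ⟨fun v y => hmp.measurable (hZ v y), ?_⟩
  have hlegal : MeasurableSet {p | ¬ P.legal G x (Z p)} :=
    measurableSet_of_countable_out hZ fun y => ¬ P.legal G x y
  refine (hmp.measureReal_preimage hlegal.nullMeasurableSet).trans_le ?_
  let B : Set (Fin n → ℕ → Bool) := {b | ∃ u, ¬ colour G ident b r R m u < m}
  have hB : MeasurableSet B := measurableSet_setOfPred.2 <| .exists fun u => .not <|
    measurableSet_setOfPred.1 ((measurable_colour G ident r R m u) measurableSet_Iio)
  have hsub : {p | ¬ P.legal G x (Z p)} ⊆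
      ({p | ¬ P.legal G x (Z p)} ∩ Bᶜ ×ˢ Set.univ) ∪ B ×ˢ Set.univ := by
    intro p hp
    by_cases hpB : p.1 ∈ B
    · exact .inr ⟨hpB, trivial⟩
    · exact .inl ⟨hp, hpB, trivial⟩
  refine (measureReal_mono hsub).trans ((measureReal_union_le _ _).trans (add_le_add ?_ ?_))
  · refine ENNReal.toReal_le_of_le_ofReal hε ?_
    rw [Measure.prod_apply (hlegal.inter (hB.compl.prod .univ))]
    -- Integrate over the clustering bits `b`. Outside `B` no default output occurs, and the section
    -- is an error event of `A` for one fixed order.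
    refine (lintegral_mono (g := fun _ => ENNReal.ofReal ε) fun b => ?_).trans (by simp)
    by_cases hb : b ∈ B
    · rw [show Prod.mk b ⁻¹' ({p | ¬ P.legal G x (Z p)} ∩ Bᶜ ×ˢ Set.univ) = ∅ from
        Set.eq_empty_of_forall_notMem fun γ hγ => hγ.2.1 hb, measure_empty]
      exact zero_le
    · refine le_trans (measure_mono fun γ hγ => ?_) (ENNReal.ofReal_toReal (measure_ne_top
        (nodeBits n) _) ▸ ENNReal.ofReal_le_ofReal
        (hA (Tuple.sort (priority G ident b r R m))).2)
      refine fun hl => hγ.1 ?_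
      convert hl using 1
      funext v
      exact if_pos (not_not.1 fun hv => hb ⟨v, hv⟩)
  · rw [measureReal_prod_prod, probReal_univ, mul_one]
    exact nodeBits_exists_unclustered_le G ident r R hid m

end Simulation

/-! ### Polylogarithmic functions -/

theorem isBigO_log_pow_mono {d e : ℕ} (h : d ≤ e) :
    (fun n : ℕ => Real.log n ^ d) =O[atTop] fun n : ℕ => Real.log n ^ e := by
  refine IsBigO.of_bound 1 ?_
  filter_upwards [(Real.tendsto_log_atTop.comp (tendsto_natCast_atTop_atTop (R := ℝ))).eventually_ge_atTop (1 : ℝ)]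
    with n hn
  have hn : 1 ≤ Real.log n := hn
  rw [one_mul, Real.norm_of_nonneg (by positivity), Real.norm_of_nonneg (by positivity)]
  exact pow_le_pow_right₀ hn h

theorem isPolylog_const (a : ℕ) : IsPolylog fun _ => a :=
  ⟨0, by simpa using isBigO_const_const (a : ℝ) (one_ne_zero (α := ℝ)) atTop⟩

theorem IsPolylog.add {f g : ℕ → ℕ} (hf : IsPolylog f) (hg : IsPolylog g) :
    IsPolylog fun n => f n + g n := by
  obtain ⟨d, hd⟩ := hf
  obtain ⟨e, he⟩ := hg
  refine ⟨max d e, ?_⟩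
  push_cast
  exact (hd.trans (isBigO_log_pow_mono (le_max_left _ _))).add
    (he.trans (isBigO_log_pow_mono (le_max_right _ _)))

theorem IsPolylog.mul {f g : ℕ → ℕ} (hf : IsPolylog f) (hg : IsPolylog g) :
    IsPolylog fun n => f n * g n := by
  obtain ⟨d, hd⟩ := hf
  obtain ⟨e, he⟩ := hg
  refine ⟨d + e, ?_⟩
  simp only [pow_add]
  push_cast
  exact hd.mul he

theorem isPolylog_log : IsPolylog (Nat.log 2) := by
  refine ⟨1, IsBigO.of_bound (1 / Real.log 2) ?_⟩
  filter_upwards [eventually_ge_atTop 1] with n hn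
  have h2 : 0 < Real.log 2 := Real.log_pos one_lt_two
  have hn' : (1 : ℝ) ≤ n := by exact_mod_cast hn
  rw [pow_one, Real.norm_of_nonneg (by positivity), Real.norm_of_nonneg (Real.log_nonneg hn'),
    div_mul_eq_mul_div, one_mul, le_div_iff₀ h2, ← Real.log_pow]
  refine Real.log_le_log (by positivity) ?_
  exact_mod_cast Nat.pow_log_le_self 2 (by omega)

/-- The number of phases of the clustering. -/
noncomputable def phases (c : ℝ) (n : ℕ) : ℕ := (⌈c⌉₊ + 4) * (Nat.log 2 n + 1)

theorem isPolylog_phases (c : ℝ) : IsPolylog (phases c) :=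
  (isPolylog_const _).mul (isPolylog_log.add (isPolylog_const 1))

/-- Since n + 1 ≤ 2^(log n + 1), the power of two is at least (n + 1)^(⌈c⌉ + 4); the exponent 4
absorbs the factor n(1 + 2n) left by the union bounds. -/
theorem failure_bound (c : ℝ) {n : ℕ} (hn : 1 ≤ n) :
    n * ((1 / 2 : ℝ) ^ phases c n + 2 * n * (1 / 2) ^ phases c n) ≤ 1 / (n : ℝ) ^ c := by
  have hn1 : (1 : ℝ) ≤ n := by exact_mod_cast hn
  have hn0 : (0 : ℝ) < n := by linarith
  have hpow : (n + 1 : ℝ) ^ (⌈c⌉₊ + 4) ≤ 2 ^ phases c n := by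
    rw [phases, mul_comm, pow_mul]
    gcongr
    exact_mod_cast Nat.lt_pow_succ_log_self one_lt_two n
  have hc : (n : ℝ) ^ c ≤ (n + 1 : ℝ) ^ ⌈c⌉₊ := by
    calc (n : ℝ) ^ c ≤ (n : ℝ) ^ (⌈c⌉₊ : ℝ) := Real.rpow_le_rpow_of_exponent_le hn1 (Nat.le_ceil c)
      _ = (n : ℝ) ^ ⌈c⌉₊ := Real.rpow_natCast _ _
      _ ≤ _ := by gcongr; linarith
  have h4 : (n : ℝ) * (1 + 2 * n) ≤ (n + 1 : ℝ) ^ 4 := by nlinarith [sq_nonneg ((n : ℝ) ^ 2)]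
  rw [le_div_iff₀ (by positivity), one_div, inv_pow]
  calc n * ((2 ^ phases c n)⁻¹ + 2 * n * (2 ^ phases c n)⁻¹) * (n : ℝ) ^ c
      = (n : ℝ) ^ c * (n * (1 + 2 * n)) / 2 ^ phases c n := by ring
    _ ≤ (n + 1 : ℝ) ^ ⌈c⌉₊ * (n + 1 : ℝ) ^ 4 / (n + 1 : ℝ) ^ (⌈c⌉₊ + 4) := by gcongr
    _ = 1 := by rw [← pow_add, div_self (by positivity)]

/-! ### The main theorem -/

theorem polyRandSLOCAL_subset (k : ℕ) (c : ℝ) (ε : ℕ → ℝ) (hε : ∀ n, 0 ≤ ε n) :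
    PolyRandSLOCAL k ε ⊆ PolyRandLOCAL k (fun n => ε n + 1 / (n : ℝ) ^ c) := by
  rintro P ⟨t, ht, A, hA⟩
  have hm := isPolylog_phases c
  refine ⟨fun n => phases c n * (2 * (phases c n * t n) + t n) + 1 + phases c n * t n,
    ((hm.mul (((isPolylog_const 2).mul (hm.mul ht)).add ht)).add (isPolylog_const 1)).add
      (hm.mul ht), ?_⟩
  rcases isEmpty_or_nonempty P.Out with hO | ⟨⟨o⟩⟩
  -- Without outputs there can be no inputs, as `A` would turn an input into an output; the claim is
  -- then vacuous.
  · have : IsEmpty P.In := ⟨fun a => hO.false (A.out (A.init 0 0 (a, fun _ => false)))⟩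
    exact ⟨⟨Empty, Empty, fun _ _ l => (this.false l.1).elim, fun s _ => s, fun s _ => s,
      fun s => s.elim⟩, fun n hn G ident _ x => (this.false (x ⟨0, hn⟩)).elim⟩
  · have : Nonempty P.Out := ⟨o⟩
    obtain ⟨B, hB⟩ := exists_localAlgorithm
      (fun n => phases c n * (2 * (phases c n * t n) + t n) + 1 + phases c n * t n)
      (fun {n} N v => simulation A (t n) (phases c n) (phases c n) o N v)
      fun N N' v v' h => clusterOutput_eq_of_agree A _ _ _ _ _ o h
    refine ⟨B, fun n hn G ident hid x => ?_⟩
    have hsim := solvesWithError_simulation P (R := phases c n) (m := phases c n) (o := o) (hε n)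
      hid.1 (hA n hn G ident hid x)
    have heq : (fun ω : Fin n → ℕ → Bool => B.output G ident (fun v => (x v, ω v))
        (phases c n * (2 * (phases c n * t n) + t n) + 1 + phases c n * t n)) =
        fun ω => simulation A (t n) (phases c n) (phases c n) o
          ⟨G, ident, hid.1, fun v => (x v, ω v)⟩ :=
      funext fun ω => funext fun v => hB ⟨G, ident, hid.1, fun v => (x v, ω v)⟩ v
    rw [heq]
    exact ⟨hsim.1, hsim.2.trans (add_le_add le_rfl (failure_bound c hn))⟩

theorem pSLOCAL_subset_polyRandSLOCAL (k : ℕ) : PSLOCAL k ⊆ PolyRandSLOCAL k fun _ => 0 := by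
  rintro P ⟨t, ht, A, hA⟩
  refine ⟨t, ht, ⟨A.State, fun n i l => A.init n i l.1, A.step, A.out⟩,
    fun n hn G ident hid x π => ⟨fun v o => .const (A.output G ident x (t n) π v = o), ?_⟩⟩
  have h : {ω : Fin n → ℕ → Bool | ¬ P.legal G x (A.output G ident x (t n) π)} = ∅ :=
    Set.eq_empty_of_forall_notMem fun ω hω => hω (hA n hn G ident hid x π)
  exact (congrArg (nodeBits n).real h).trans_le (by simp)

theorem mainTheorem6 (k : ℕ) (hk : 1 ≤ k) (c : ℝ) (hc : 0 < c) :
    (∀ ε : ℕ → ℝ, (∀ n, 0 ≤ ε n) →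
      PolyRandSLOCAL k ε ⊆ PolyRandLOCAL k (fun n => ε n + 1 / (n : ℝ) ^ c)) ∧
    PSLOCAL k ⊆ PolyRandLOCAL k (fun n => 1 / (n : ℝ) ^ c) := by
  refine ⟨fun ε hε => polyRandSLOCAL_subset k c ε hε, ?_⟩
  refine (pSLOCAL_subset_polyRandSLOCAL k).trans ?_
  simpa using polyRandSLOCAL_subset k c (fun _ => 0) fun _ => le_rfl
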